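/- Let $p \in \mathbb{R}[x,y,z]$ be a non-zero polynomial of (total) degree $\deg p$, and let $Z = \{v \in \mathbb{R}^3 : p(v) = 0\}$. Then $Z$ contains at most $(\deg p)^2$ critical irreducible real algebraic curves of $\mathbb{R}^3$; in particular there are only finitely many. Here a variety in $\mathbb{R}^3$ is the set of common zeros of finitely many real polynomials; it is irreducible if it is non-empty and is not the union of two varieties that are strict subsets of it. The dimension of an irreducible variety $V$ is the transcendence degree over $\mathbb{R}$ of $\mathbb{R}[x,y,z]/I(V)$, where $I(V)$ is the ideal of the polynomials that vanish on $V$; the dimension of a variety is the maximal dimension of the irreducible varieties contained in it, and a real algebraic curve is a variety of dimension $1$. Let $p_{sf}$ be the square-free part of $p$, i.e. the product of the distinct irreducible factors of $p$ in $\mathbb{R}[x,y,z]$ (distinct up to constants). A point $v \in Z$ is a critical point of $Z$ if $\nabla p_{sf}(v) = 0$, and a curve $\gamma \subseteq Z$ is critical if each of its points is a critical point of $Z$. -/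

import Mathlib

namespace AffineGeometry

open MvPolynomial

variable {K : Type*} [Field K] {n : ℕ}

/-- The zero set in `Kⁿ` of a polynomial in `n` variables. -/
def zeroSet (p : MvPolynomial (Fin n) K) : Set (Fin n → K) :=
  {x | eval x p = 0}

/-- A variety (algebraic set) in `Kⁿ`: the set of common zeros of finitely many polynomials. -/
def IsVariety (V : Set (Fin n → K)) : Prop :=
  ∃ S : Finset (MvPolynomial (Fin n) K), V = {x | ∀ p ∈ S, eval x p = 0}

/-- An irreducible variety: a non-empty variety which is not the union of two varieties that are
strict subsets of it. -/
def IsIrreducibleVariety (V : Set (Fin n → K)) : Prop :=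
  IsVariety V ∧ V.Nonempty ∧
    ¬ ∃ A B : Set (Fin n → K), IsVariety A ∧ IsVariety B ∧ A ⊂ V ∧ B ⊂ V ∧ V = A ∪ B

/-- The transcendence degree over `K` of the coordinate ring `K[x₁, …, xₙ] / I(V)`, which is
the dimension of `V` when `V` is an irreducible variety. -/
noncomputable def irreducibleDim (V : Set (Fin n → K)) : Cardinal :=
  Algebra.trdeg K (MvPolynomial (Fin n) K ⧸ vanishingIdeal K V)

/-- An algebraic curve: a variety of dimension `1`, where the dimension of a variety is the maximal
dimension of the irreducible varieties contained in it. -/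
def IsAlgebraicCurve (V : Set (Fin n → K)) : Prop :=
  IsVariety V ∧
    (∃ W, W ⊆ V ∧ IsIrreducibleVariety W ∧ irreducibleDim W = 1) ∧
    ∀ W, W ⊆ V → IsIrreducibleVariety W → irreducibleDim W ≤ 1

/-- An irreducible algebraic curve. -/
def IsIrreducibleCurve (V : Set (Fin n → K)) : Prop :=
  IsAlgebraicCurve V ∧ IsIrreducibleVariety V

/-- The square-free part of a non-zero polynomial: the product of its distinct irreducible factors,
one being taken from each class of factors that agree up to a non-zero constant. It is determined up
to a non-zero constant factor. -/
noncomputable def squarefreePart (p : MvPolynomial (Fin n) K) : MvPolynomial (Fin n) K :=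
  letI : StrongNormalizationMonoid (MvPolynomial (Fin n) K) :=
    UniqueFactorizationMonoid.strongNormalizationMonoid
  UniqueFactorizationMonoid.radical p

/-- A critical point of the zero set of a non-zero polynomial `p`: a point of the zero set at which
the gradient of the square-free part of `p` vanishes. -/
def IsCriticalPoint (p : MvPolynomial (Fin n) K) (x : Fin n → K) : Prop :=
  x ∈ zeroSet p ∧ ∀ i, eval x (pderiv i (squarefreePart p)) = 0

/-- A set of points, such as a curve, is critical for the zero set of `p` if each of its points is a
critical point of the zero set. -/
def IsCritical (p : MvPolynomial (Fin n) K) (γ : Set (Fin n → K)) : Prop :=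
  ∀ x ∈ γ, IsCriticalPoint p x

end AffineGeometry

/-
A critical variety lies on the zero set of the square-free part `q` of `p` and on the zero set of
every directional derivative of `q`. For a generic direction the derivative is coprime to `q`, since
it does not kill any irreducible factor of `q` and lowers its degree. The bound is then a Bézout
inequality for the varieties of codimension two that lie on two hypersurfaces `f = 0` and `g = 0`
without common component.

That inequality is obtained by estimating in two ways the Hilbert function of the intersection `I`
of the prime ideals `P i` of `N` such varieties, all of dimension `n`. The multiples of `f` and `g`
in `I` bound it from above by `deg f * deg g * (m + n).choose n`. For a lower bound, choose `s i`
outside `P i` but in all the other primes, and `n` variables that are algebraically independent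
modulo `P i`: the multiples of `s i` by polynomials in these variables are independent modulo `I`,
also for all `i` together, whence at least `N * (m - e).choose n` with `e` independent of `m`.
Comparing growth as `m` tends to infinity gives `N ≤ deg f * deg g`.
-/

namespace AffineGeometry

open MvPolynomial

section Binomial

open Asymptotics Filter Topology

theorem choose_add_succ_le (n k a : ℕ) :
    (k + a + (n + 1)).choose (n + 1) ≤
      (k + (n + 1)).choose (n + 1) + a * (k + a + n).choose n := by
  induction a with
  | zero => simp
  | succ a ih =>
    have pascal : (k + (a + 1) + (n + 1)).choose (n + 1) =
        (k + (a + 1) + n).choose n + (k + a + (n + 1)).choose (n + 1) := by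
      rw [← add_assoc, Nat.choose_succ_succ', show k + (a + 1) + n = k + a + (n + 1) by ring]
    have mono : (k + a + n).choose n ≤ (k + (a + 1) + n).choose n :=
      Nat.choose_le_choose n (by lia)
    have := Nat.mul_le_mul_left a mono
    linarith

theorem choose_add_add_le (n k a b : ℕ) :
    (k + a + b + (n + 2)).choose (n + 2) + (k + (n + 2)).choose (n + 2) ≤
      (k + a + (n + 2)).choose (n + 2) + (k + b + (n + 2)).choose (n + 2) +
        a * b * (k + a + b + n).choose n := by
  induction b with
  | zero => simp [add_comm]
  | succ b ih =>
    have pascal (j : ℕ) : (j + (b + 1) + (n + 2)).choose (n + 2) =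
        (j + (b + 1) + (n + 1)).choose (n + 1) + (j + b + (n + 2)).choose (n + 2) := by
      rw [show j + (b + 1) + (n + 2) = j + (b + 1) + (n + 1) + 1 by ring, Nat.choose_succ_succ',
        show j + (b + 1) + (n + 1) = j + b + (n + 2) by ring]
    have first := choose_add_succ_le n (k + (b + 1)) a
    rw [add_right_comm k (b + 1) a] at first
    have mono : (k + a + b + n).choose n ≤ (k + a + (b + 1) + n).choose n :=
      Nat.choose_le_choose n (by lia)
    have := Nat.mul_le_mul_left (a * b) mono
    rw [pascal, pascal]
    linarith

theorem isEquivalent_add_choose (c n : ℕ) :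
    (fun m : ℕ => ((m + c).choose n : ℝ)) ~[atTop] fun m => (m ^ n / n.factorial : ℝ) := by
  have shift : (fun m : ℕ => ((m + c : ℕ) : ℝ)) ~[atTop] fun m => (m : ℝ) := by
    simp only [Nat.cast_add]
    exact IsEquivalent.refl.add_isLittleO
      (isLittleO_const_left.mpr (.inr (tendsto_norm_atTop_atTop.comp tendsto_natCast_atTop_atTop)))
  exact ((isEquivalent_choose n).comp_tendsto (tendsto_add_atTop_nat c)).trans
    ((shift.pow n).div .refl)

theorem le_of_forall_mul_add_choose_le {N D c d n : ℕ}
    (h : ∀ m, N * (m + c).choose n ≤ D * (m + d).choose n) : N ≤ D := by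
  have tendsto_ratio (M e : ℕ) : Tendsto
      (fun m : ℕ => (M * (m + e).choose n : ℝ) / (m ^ n / n.factorial : ℝ)) atTop (𝓝 M) := by
    have hne : ∀ᶠ m : ℕ in atTop, (m ^ n / n.factorial : ℝ) ≠ 0 := by
      filter_upwards [eventually_gt_atTop 0] with m hm
      positivity
    have := ((isEquivalent_iff_tendsto_one hne).mp (isEquivalent_add_choose e n)).const_mul (M : ℝ)
    simpa [mul_div_assoc] using this
  have hle := le_of_tendsto_of_tendsto' (tendsto_ratio N c) (tendsto_ratio D d) fun m => by
    gcongr ?_ / _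
    exact_mod_cast h m
  exact_mod_cast hle

end Binomial

section HilbertFunction

variable {K σ : Type*} [Field K]

theorem finrank_restrictTotalDegree [Fintype σ] (m : ℕ) :
    Module.finrank K (restrictTotalDegree σ K m) =
      (m + Fintype.card σ).choose (Fintype.card σ) := by
  classical
  have exponents : {s : σ →₀ ℕ | (s.sum fun _ e => e) ≤ m} =
      ((Finset.range (m + 1)).biUnion fun k => (Finset.univ : Finset σ).finsuppAntidiag k :
        Finset (σ →₀ ℕ)) := by
    ext s
    simp [Finsupp.sum_fintype]
  rw [restrictTotalDegree, Module.finrank_eq_nat_card_basis (basisRestrictSupport K _), exponents,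
    Nat.card_coe_set_eq, Set.ncard_coe_finset, Finset.card_biUnion]
  · simp only [Finset.card_finsuppAntidiag_nat_eq_multichoose, Finset.card_univ,
      Nat.sum_range_multichoose]
  · intro i _ j _ hij
    rw [Function.onFun, Finset.disjoint_left]
    intro s hi hj
    exact hij ((Finset.mem_finsuppAntidiag.mp hi).1.symm.trans (Finset.mem_finsuppAntidiag.mp hj).1)

/-- The affine Hilbert function of an ideal `I`: the dimension of the space of residue classes
modulo `I` of the polynomials of total degree at most `m`. -/
noncomputable def affineHilbertFunction (I : Ideal (MvPolynomial σ K)) (m : ℕ) : ℕ :=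
  Module.finrank K ((restrictTotalDegree σ K m).map (Ideal.Quotient.mkₐ K I).toLinearMap)

theorem affineHilbertFunction_add_finrank_le [Finite σ] {I : Ideal (MvPolynomial σ K)} {m : ℕ}
    {T : Submodule K (MvPolynomial σ K)} (hT : T ≤ restrictTotalDegree σ K m)
    (hTI : T ≤ I.restrictScalars K) :
    affineHilbertFunction I m + Module.finrank K T ≤
      Module.finrank K (restrictTotalDegree σ K m) := by
  set mk := (Ideal.Quotient.mkₐ K I).toLinearMap.domRestrict (restrictTotalDegree σ K m)
  have kernel : T.submoduleOf (restrictTotalDegree σ K m) ≤ mk.ker := fun x hx =>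
    Ideal.Quotient.eq_zero_iff_mem.mpr (hTI hx)
  calc affineHilbertFunction I m + Module.finrank K T
      = Module.finrank K mk.range +
          Module.finrank K (T.submoduleOf (restrictTotalDegree σ K m)) := by
        rw [LinearMap.range_domRestrict, (Submodule.submoduleOfEquivOfLe hT).finrank_eq]
        rfl
    _ ≤ Module.finrank K mk.range + Module.finrank K mk.ker := by
        gcongr
        exact Submodule.finrank_mono kernel
    _ = _ := mk.finrank_range_add_finrank_ker

theorem finrank_map_mulLeft {f : MvPolynomial σ K} (hf : f ≠ 0)
    (S : Submodule K (MvPolynomial σ K)) :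
    Module.finrank K (S.map (LinearMap.mulLeft K f)) = Module.finrank K S :=
  (Submodule.equivMapOfInjective _ (fun _ _ h => mul_left_cancel₀ hf h) S).symm.finrank_eq

theorem map_mulLeft_restrictTotalDegree_le {f : MvPolynomial σ K} {k m : ℕ}
    (h : f.totalDegree + k ≤ m) :
    (restrictTotalDegree σ K k).map (LinearMap.mulLeft K f) ≤ restrictTotalDegree σ K m := by
  rintro _ ⟨u, hu, rfl⟩
  rw [SetLike.mem_coe, mem_restrictTotalDegree] at hu
  rw [mem_restrictTotalDegree, LinearMap.mulLeft_apply]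
  exact (totalDegree_mul f u).trans (by lia)

theorem map_mulLeft_inf_map_mulLeft_le {f g : MvPolynomial σ K} (hg : g ≠ 0)
    (hfg : IsRelPrime f g) (k l : ℕ) :
    (restrictTotalDegree σ K (k + g.totalDegree)).map (LinearMap.mulLeft K f) ⊓
        (restrictTotalDegree σ K l).map (LinearMap.mulLeft K g) ≤
      (restrictTotalDegree σ K k).map (LinearMap.mulLeft K (f * g)) := by
  rintro _ ⟨⟨u, hu, rfl⟩, ⟨w, -, huw : g * w = f * u⟩⟩
  obtain ⟨c, rfl⟩ : g ∣ u := hfg.symm.dvd_of_dvd_mul_left ⟨w, huw.symm⟩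
  refine ⟨c, ?_, by simp⟩
  rw [SetLike.mem_coe, mem_restrictTotalDegree] at hu ⊢
  rcases eq_or_ne c 0 with rfl | hc
  · simp
  · rw [totalDegree_mul_of_isDomain hg hc] at hu
    lia

/- The multiples `f u` and `g w` of total degree at most `k + deg f + deg g` lie in `I`, and since
`f` and `g` are coprime the only coincidences among them are the multiples of `f g`. -/
theorem affineHilbertFunction_add_finrank_add_finrank_le [Finite σ] {I : Ideal (MvPolynomial σ K)}
    {f g : MvPolynomial σ K} (hf : f ≠ 0) (hg : g ≠ 0) (hfg : IsRelPrime f g) (hfI : f ∈ I)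
    (hgI : g ∈ I) (k : ℕ) :
    affineHilbertFunction I (k + f.totalDegree + g.totalDegree) +
        (Module.finrank K (restrictTotalDegree σ K (k + f.totalDegree)) +
          Module.finrank K (restrictTotalDegree σ K (k + g.totalDegree))) ≤
      Module.finrank K (restrictTotalDegree σ K (k + f.totalDegree + g.totalDegree)) +
        Module.finrank K (restrictTotalDegree σ K k) := by
  set F := (restrictTotalDegree σ K (k + g.totalDegree)).map (LinearMap.mulLeft K f)
  set G := (restrictTotalDegree σ K (k + f.totalDegree)).map (LinearMap.mulLeft K g)
  have degree : F ⊔ G ≤ restrictTotalDegree σ K (k + f.totalDegree + g.totalDegree) :=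
    sup_le (map_mulLeft_restrictTotalDegree_le (by lia))
      (map_mulLeft_restrictTotalDegree_le (by lia))
  have mem_ideal : F ⊔ G ≤ I.restrictScalars K :=
    sup_le (Submodule.map_le_iff_le_comap.mpr fun u _ => I.mul_mem_right u hfI)
      (Submodule.map_le_iff_le_comap.mpr fun u _ => I.mul_mem_right u hgI)
  have upper := affineHilbertFunction_add_finrank_le degree mem_ideal
  have inclusion_exclusion := Submodule.finrank_sup_add_finrank_inf_eq F G
  have overlap : Module.finrank K ↥(F ⊓ G) ≤ Module.finrank K (restrictTotalDegree σ K k) :=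
    (Submodule.finrank_mono (map_mulLeft_inf_map_mulLeft_le hg hfg k _)).trans_eq
      (finrank_map_mulLeft (mul_ne_zero hf hg) _)
  have finrank_F : Module.finrank K F = _ := finrank_map_mulLeft hf _
  have finrank_G : Module.finrank K G = _ := finrank_map_mulLeft hg _
  lia

theorem affineHilbertFunction_le_of_isRelPrime [Fintype σ] {n : ℕ}
    (hσ : Fintype.card σ = n + 2) {I : Ideal (MvPolynomial σ K)}
    {f g : MvPolynomial σ K} (hf : f ≠ 0) (hg : g ≠ 0) (hfg : IsRelPrime f g) (hfI : f ∈ I)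
    (hgI : g ∈ I) (k : ℕ) :
    affineHilbertFunction I (k + f.totalDegree + g.totalDegree) ≤
      f.totalDegree * g.totalDegree * (k + f.totalDegree + g.totalDegree + n).choose n := by
  have := affineHilbertFunction_add_finrank_add_finrank_le hf hg hfg hfI hgI k
  simp only [finrank_restrictTotalDegree, hσ] at this
  have := choose_add_add_le n k f.totalDegree g.totalDegree
  lia

end HilbertFunction

section PrimeIdeals

open Algebra

universe v

theorem injective_of_surjective_of_trdeg_le {R : Type*} {A B : Type v} [CommRing R] [CommRing A]
    [IsDomain A] [Algebra R A] [CommRing B] [IsDomain B] [Algebra R B] [FaithfulSMul R B]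
    {φ : A →ₐ[R] B} (hφ : Function.Surjective φ) (hA : trdeg R A < .aleph0)
    (h : trdeg R A ≤ trdeg R B) : Function.Injective φ := by
  have := (FaithfulSMul.algebraMap_injective R B).isDomain
  obtain ⟨ι, y, hy⟩ := exists_isTranscendenceBasis' R B
  obtain ⟨x, rfl⟩ : ∃ x : ι → A, φ ∘ x = y :=
    ⟨Function.surjInv hφ ∘ y, funext fun i => Function.surjInv_eq hφ (y i)⟩
  have := ((hy.1.of_comp φ).isTranscendenceBasis_of_trdeg_le hA
    (h.trans_eq hy.cardinalMk_eq_trdeg.symm)).isAlgebraic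
  rw [injective_iff_map_eq_zero]
  by_contra! ⟨u, hu, hu0⟩
  obtain ⟨r, hr0, hur⟩ := (Algebra.IsAlgebraic.isAlgebraic
    (R := adjoin R (Set.range x)) u).exists_nonzero_dvd (mem_nonZeroDivisors_of_ne_zero hu0)
  obtain ⟨F, hF : aeval x F = r⟩ := (adjoin_range_eq_range_aeval R x).le r.2
  have aeval_eq_zero : aeval (φ ∘ x) F = 0 := by
    rw [Function.comp_def, ← comp_aeval_apply, hF]
    exact zero_dvd_iff.mp (hu ▸ map_dvd φ hur)
  have F_eq_zero : F = 0 := algebraicIndependent_iff.mp hy.1 F aeval_eq_zero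
  rw [F_eq_zero, map_zero] at hF
  exact hr0 (Subtype.ext hF.symm)

theorem eq_of_le_of_trdeg_quotient_le {K A : Type*} [Field K] [CommRing A] [Algebra K A]
    [Algebra.FiniteType K A] {P Q : Ideal A} [P.IsPrime] [Q.IsPrime] (hPQ : P ≤ Q)
    (h : trdeg K (A ⧸ P) ≤ trdeg K (A ⧸ Q)) : P = Q := by
  have injective : Function.Injective (Ideal.Quotient.factorₐ K hPQ) :=
    injective_of_surjective_of_trdeg_le (Ideal.Quotient.factor_surjective hPQ)
      trdeg_lt_aleph0_of_finiteType h
  refine hPQ.antisymm fun f hf => ?_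
  rw [← Ideal.Quotient.eq_zero_iff_mem] at hf ⊢
  exact injective (by simpa using hf)

theorem exists_algebraicIndependent_comp {ι K A : Type*} [Field K] [CommRing A] [IsDomain A]
    [Algebra K A] (x : ι → A) [Algebra.IsAlgebraic (adjoin K (Set.range x)) A] {n : ℕ}
    (h : trdeg K A = n) : ∃ k : Fin n → ι, AlgebraicIndependent K (x ∘ k) := by
  obtain ⟨t, ht, basis⟩ := exists_isTranscendenceBasis_subset (R := K) (Set.range x)
  obtain ⟨e : t ≃ Fin n⟩ := Cardinal.mk_eq_nat_iff.mp (basis.cardinalMk_eq_trdeg.trans h)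
  choose k hk using fun j => ht (e.symm j).2
  have comp_eq : x ∘ k = Subtype.val ∘ e.symm := funext hk
  exact ⟨k, comp_eq ▸ basis.1.comp e.symm e.symm.injective⟩

theorem exists_algebraicIndependent_mk_X {K σ : Type*} [Field K] {P : Ideal (MvPolynomial σ K)}
    [P.IsPrime] {n : ℕ} (h : trdeg K (MvPolynomial σ K ⧸ P) = n) :
    ∃ k : Fin n → σ, AlgebraicIndependent K fun j => Ideal.Quotient.mkₐ K P (X (k j)) := by
  have adjoin_eq_top : adjoin K (Set.range (Ideal.Quotient.mkₐ K P ∘ X)) = ⊤ := by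
    rw [Set.range_comp, adjoin_image, adjoin_range_X, Algebra.map_top,
      (AlgHom.range_eq_top _).mpr (Ideal.Quotient.mkₐ_surjective K P)]
  have : Algebra.IsAlgebraic (adjoin K (Set.range (Ideal.Quotient.mkₐ K P ∘ X)))
      (MvPolynomial σ K ⧸ P) :=
    ⟨fun a => isAlgebraic_algebraMap (⟨a, adjoin_eq_top ▸ mem_top⟩ : adjoin K _)⟩
  exact exists_algebraicIndependent_comp (Ideal.Quotient.mkₐ K P ∘ X) h

theorem exists_notMem_forall_ne_mem {ι A : Type*} [Finite ι] [CommSemiring A] {P : ι → Ideal A}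
    [∀ i, (P i).IsPrime] (hP : ∀ i j, P i ≤ P j → i = j) (i : ι) :
    ∃ s ∉ P i, ∀ j ≠ i, s ∈ P j := by
  classical
  cases nonempty_fintype ι
  have not_le : ¬ (Finset.univ.erase i).inf P ≤ P i := by
    rw [Ideal.IsPrime.inf_le' inferInstance]
    rintro ⟨j, hj, hji⟩
    exact Finset.ne_of_mem_erase hj (hP j i hji)
  obtain ⟨s, hs, hsi⟩ := SetLike.not_le_iff_exists.mp not_le
  refine ⟨s, hsi, fun j hj => ?_⟩
  exact Finset.inf_le (f := P) (Finset.mem_erase.mpr ⟨hj, Finset.mem_univ j⟩) hs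

end PrimeIdeals

section Bezout

variable {K σ ι : Type*} [Field K] {P : ι → Ideal (MvPolynomial σ K)} [∀ i, (P i).IsPrime]
  {n : ℕ}

theorem eq_zero_of_sum_mul_rename_mem [Fintype ι] {i : ι} {s : ι → MvPolynomial σ K}
    (hsi : s i ∉ P i) (hs : ∀ j ≠ i, s j ∈ P i) {k : ι → Fin n → σ}
    (hk : AlgebraicIndependent K fun l => Ideal.Quotient.mkₐ K (P i) (X (k i l)))
    {u : ι → MvPolynomial (Fin n) K} (hu : ∑ j, s j * rename (k j) (u j) ∈ P i) : u i = 0 := by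
  classical
  have mem : s i * rename (k i) (u i) ∈ P i := by
    rw [← Finset.add_sum_erase _ _ (Finset.mem_univ i)] at hu
    refine ((P i).add_mem_iff_left (sum_mem fun j hj => ?_)).mp hu
    exact (P i).mul_mem_right _ (hs j (Finset.ne_of_mem_erase hj))
  refine algebraicIndependent_iff.mp hk (u i) ?_
  have rename_mem := (Ideal.IsPrime.mem_or_mem inferInstance mem).resolve_left hsi
  rw [rename_eq_aeval, ← Ideal.Quotient.eq_zero_iff_mem] at rename_mem
  rw [← comp_aeval_apply]
  exact rename_mem

theorem exists_card_mul_choose_le_affineHilbertFunction [Finite σ] [Fintype ι]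
    (hP : ∀ i j, P i ≤ P j → i = j) (hdim : ∀ i, Algebra.trdeg K (MvPolynomial σ K ⧸ P i) = n) :
    ∃ e, ∀ m, Fintype.card ι * (m + n).choose n ≤ affineHilbertFunction (⨅ i, P i) (m + e) := by
  choose s hsi hs using exists_notMem_forall_ne_mem hP
  choose k hk using fun i => exists_algebraicIndependent_mk_X (hdim i)
  refine ⟨Finset.univ.sup fun i => (s i).totalDegree, fun m => ?_⟩
  set e := Finset.univ.sup fun i => (s i).totalDegree
  let φ : (ι → restrictTotalDegree (Fin n) K m) →ₗ[K] MvPolynomial σ K :=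
    ∑ i, LinearMap.mulLeft K (s i) ∘ₗ (rename (k i)).toLinearMap ∘ₗ
      (restrictTotalDegree (Fin n) K m).subtype ∘ₗ LinearMap.proj i
  have φ_apply (u) : φ u = ∑ i, s i * rename (k i) (u i : MvPolynomial (Fin n) K) := by simp [φ]
  have degree : φ.range ≤ restrictTotalDegree σ K (m + e) := by
    rintro _ ⟨u, rfl⟩
    rw [φ_apply]
    refine sum_mem fun i _ => (mem_restrictTotalDegree ..).mpr ?_
    calc (s i * rename (k i) (u i : MvPolynomial (Fin n) K)).totalDegree
        ≤ (s i).totalDegree + (rename (k i) (u i : MvPolynomial (Fin n) K)).totalDegree :=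
          totalDegree_mul ..
      _ ≤ e + m := add_le_add (Finset.le_sup (f := fun i => (s i).totalDegree) (Finset.mem_univ i))
          ((totalDegree_rename_le ..).trans ((mem_restrictTotalDegree ..).mp (u i).2))
      _ = m + e := add_comm e m
  set mk := (Ideal.Quotient.mkₐ K (⨅ i, P i)).toLinearMap
  have injective : Function.Injective (mk ∘ₗ φ) := by
    refine (injective_iff_map_eq_zero _).mpr fun u hu => funext fun i => Subtype.ext ?_
    have mem : φ u ∈ P i := (Ideal.mem_iInf ..).mp (Ideal.Quotient.eq_zero_iff_mem.mp hu) i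
    rw [φ_apply] at mem
    exact eq_zero_of_sum_mul_rename_mem (hsi i) (fun j hj => hs j i hj.symm) (hk i) mem
  calc Fintype.card ι * (m + n).choose n
      = Module.finrank K (ι → restrictTotalDegree (Fin n) K m) := by
        simp [Module.finrank_pi_fintype, finrank_restrictTotalDegree]
    _ = Module.finrank K (mk ∘ₗ φ).range := (LinearMap.finrank_range_of_inj injective).symm
    _ ≤ affineHilbertFunction (⨅ i, P i) (m + e) :=
        Submodule.finrank_mono (LinearMap.range_comp φ mk ▸ Submodule.map_mono degree)

theorem card_le_totalDegree_mul_totalDegree [Fintype σ] (hσ : Fintype.card σ = n + 2) [Fintype ι]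
    (hP : Function.Injective P) (hdim : ∀ i, Algebra.trdeg K (MvPolynomial σ K ⧸ P i) = n)
    {f g : MvPolynomial σ K} (hfg : IsRelPrime f g) (hf : ∀ i, f ∈ P i) (hg : ∀ i, g ∈ P i) :
    Fintype.card ι ≤ f.totalDegree * g.totalDegree := by
  rcases isEmpty_or_nonempty ι with _ | ⟨⟨i⟩⟩
  · simp
  have not_isUnit {h : MvPolynomial σ K} (hh : h ∈ P i) : ¬ IsUnit h := fun hu =>
    (inferInstance : (P i).IsPrime).ne_top ((P i).eq_top_of_isUnit_mem hh hu)
  have f_ne_zero : f ≠ 0 := by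
    rintro rfl
    exact not_isUnit (hg i) (isRelPrime_zero_left.mp hfg)
  have g_ne_zero : g ≠ 0 := by
    rintro rfl
    exact not_isUnit (hf i) (isRelPrime_zero_right.mp hfg)
  have incomparable (i j) (hij : P i ≤ P j) : i = j :=
    hP (eq_of_le_of_trdeg_quotient_le hij ((hdim i).trans (hdim j).symm).le)
  obtain ⟨e, he⟩ := exists_card_mul_choose_le_affineHilbertFunction incomparable hdim
  refine le_of_forall_mul_add_choose_le (n := n) (c := f.totalDegree + g.totalDegree + n)
    (d := e + f.totalDegree + g.totalDegree + n) fun m => ?_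
  have lower := he (m + f.totalDegree + g.totalDegree)
  have upper := affineHilbertFunction_le_of_isRelPrime hσ f_ne_zero g_ne_zero hfg
    ((Ideal.mem_iInf ..).mpr hf) ((Ideal.mem_iInf ..).mpr hg) (m + e)
  rw [add_right_comm _ _ e, add_right_comm m _ e] at lower
  simpa only [← add_assoc] using lower.trans upper

end Bezout

section DirectionalDerivative

variable {R σ : Type*}

theorem totalDegree_pderiv_le [CommSemiring R] (i : σ) (f : MvPolynomial σ R) :
    (pderiv i f).totalDegree ≤ f.totalDegree - 1 := by
  refine Finset.sup_le fun m hm => Nat.le_sub_one_of_lt ?_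
  rw [mem_support_iff, coeff_pderiv] at hm
  have hle := le_totalDegree (mem_support_iff.mpr (left_ne_zero_of_mul hm))
  rwa [Finsupp.sum_add_index' (fun _ => rfl) (fun _ _ _ => rfl),
    Finsupp.sum_single_index rfl] at hle

theorem exists_pderiv_ne_zero [CommSemiring R] [NoZeroDivisors R] [CharZero R]
    {f : MvPolynomial σ R} (hf : f.totalDegree ≠ 0) : ∃ i, pderiv i f ≠ 0 := by
  obtain ⟨m, hm, hm0⟩ : ∃ m ∈ f.support, m ≠ 0 := by
    contrapose! hf
    exact (totalDegree_eq_zero_iff ..).mpr fun m hm i => by rw [hf m hm, Finsupp.zero_apply]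
  obtain ⟨i, hi⟩ := Finsupp.ne_iff.mp hm0
  refine ⟨i, ne_zero_iff.mpr ⟨m - Finsupp.single i 1, ?_⟩⟩
  rw [coeff_pderiv, Finsupp.sub_add_single_one_cancel hi]
  exact mul_ne_zero (mem_support_iff.mp hm) (Nat.cast_add_one_ne_zero _)

theorem totalDegree_ne_zero_of_irreducible {K : Type*} [Field K] {f : MvPolynomial σ K}
    (hf : Irreducible f) : f.totalDegree ≠ 0 := fun h => by
  have f_eq := totalDegree_eq_zero_iff_eq_C.mp h
  have coeff_ne_zero : f.coeff 0 ≠ 0 := fun h0 => hf.ne_zero (by rw [f_eq, h0, C_0])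
  exact hf.not_isUnit (isUnit_iff_totalDegree_of_isReduced.mpr ⟨coeff_ne_zero.isUnit, h⟩)

theorem isRelPrime_derivation_of_squarefree {A : Type*} [CommSemiring R] [CommRing A] [IsDomain A]
    [UniqueFactorizationMonoid A] [Algebra R A] (D : Derivation R A A) {q : A} (hq : Squarefree q)
    (hD : ∀ f ∈ UniqueFactorizationMonoid.factors q, ¬ f ∣ D f) : IsRelPrime q (D q) := by
  refine WfDvdMonoid.isRelPrime_of_no_irreducible_factors (fun h => hq.ne_zero h.1) ?_
  intro r hr hrq hrD
  obtain ⟨f, hf, hrf⟩ := UniqueFactorizationMonoid.exists_mem_factors_of_dvd hq.ne_zero hr hrq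
  obtain ⟨g, rfl⟩ : f ∣ q := hrf.dvd_iff_dvd_left.mp hrq
  have f_dvd_mul : f ∣ g * D f := by
    rw [hrf.dvd_iff_dvd_left, D.leibniz, smul_eq_mul, smul_eq_mul] at hrD
    exact (dvd_add_right (dvd_mul_right _ _)).mp hrD
  rcases (UniqueFactorizationMonoid.prime_of_factor f hf).dvd_or_dvd f_dvd_mul with hfg | hfD
  · exact (UniqueFactorizationMonoid.prime_of_factor f hf).not_isUnit
      (hq f (mul_dvd_mul_left f hfg))
  · exact hD f hf hfD

/-- The derivative of polynomials in the direction of the vector `v`, as a derivation. -/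
noncomputable def dirDeriv [CommSemiring R] [Fintype σ] (v : σ → R) :
    Derivation R (MvPolynomial σ R) (MvPolynomial σ R) :=
  ∑ i, v i • pderiv i

variable [Fintype σ]

theorem dirDeriv_apply [CommSemiring R] (v : σ → R) (f : MvPolynomial σ R) :
    dirDeriv v f = ∑ i, v i • pderiv i f := by
  rw [dirDeriv, ← Derivation.coeFnAddMonoidHom_apply, map_sum, Finset.sum_apply]
  rfl

theorem eval_dirDeriv [CommSemiring R] (v x : σ → R) (f : MvPolynomial σ R) :
    eval x (dirDeriv v f) = ∑ i, v i * eval x (pderiv i f) := by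
  simp [dirDeriv_apply, smul_eval]

theorem totalDegree_dirDeriv_le [CommSemiring R] (v : σ → R) (f : MvPolynomial σ R) :
    (dirDeriv v f).totalDegree ≤ f.totalDegree - 1 := by
  rw [dirDeriv_apply]
  exact totalDegree_finsetSum_le fun i _ =>
    (totalDegree_smul_le _ _).trans (totalDegree_pderiv_le i f)

theorem not_dvd_dirDeriv [CommRing R] [IsDomain R] {v : σ → R} {f : MvPolynomial σ R}
    (h : dirDeriv v f ≠ 0) : ¬ f ∣ dirDeriv v f := fun hdvd => by
  have hf : f.totalDegree ≠ 0 := fun h0 => h <| by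
    rw [totalDegree_eq_zero_iff_eq_C.mp h0]
    exact (dirDeriv v).map_algebraMap _
  have hle := (totalDegree_le_of_dvd_of_isDomain hdvd h).trans (totalDegree_dirDeriv_le v f)
  exact Nat.not_lt_of_le hle (Nat.sub_one_lt hf)

/- Each `f j` excludes only the directions of a proper subspace, and over an infinite field finitely
many proper subspaces do not cover the whole space. -/
theorem exists_forall_dirDeriv_ne_zero {K : Type*} [Field K] [CharZero K] {ι : Type*} [Finite ι]
    {f : ι → MvPolynomial σ K} (hf : ∀ j, (f j).totalDegree ≠ 0) :
    ∃ v : σ → K, ∀ j, dirDeriv v (f j) ≠ 0 := by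
  classical
  let grad (j : ι) : (σ → K) →ₗ[K] MvPolynomial σ K :=
    Fintype.linearCombination K fun i => pderiv i (f j)
  have grad_apply (j v) : grad j v = dirDeriv v (f j) := by
    rw [dirDeriv_apply, Fintype.linearCombination_apply]
  have ker_ne_top (j : ι) : (grad j).ker ≠ ⊤ := by
    obtain ⟨i, hi⟩ := exists_pderiv_ne_zero (hf j)
    refine fun htop => hi ?_
    simpa [grad, Fintype.linearCombination_apply_single] using
      LinearMap.congr_fun (LinearMap.ker_eq_top.mp htop) (Pi.single i 1)
  obtain ⟨v, hv⟩ := Submodule.exists_forall_notMem_of_forall_ne_top _ ker_ne_top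
  exact ⟨v, fun j hj => hv j (by rw [LinearMap.mem_ker, grad_apply, hj])⟩

theorem exists_isRelPrime_dirDeriv {K : Type*} [Field K] [CharZero K] {q : MvPolynomial σ K}
    (hq : Squarefree q) : ∃ v : σ → K, IsRelPrime q (dirDeriv v q) := by
  classical
  obtain ⟨v, hv⟩ := exists_forall_dirDeriv_ne_zero
    (f := fun f : {f // f ∈ UniqueFactorizationMonoid.factors q} => (f : MvPolynomial σ K))
    fun f => totalDegree_ne_zero_of_irreducible
      (UniqueFactorizationMonoid.irreducible_of_factor _ f.2)
  exact ⟨v, isRelPrime_derivation_of_squarefree _ hq fun f hf => not_dvd_dirDeriv (hv ⟨f, hf⟩)⟩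

end DirectionalDerivative

section Varieties

variable {K : Type*} [Field K] {n : ℕ}

theorem mem_vanishingIdeal_iff_subset_zeroSet {V : Set (Fin n → K)}
    {f : MvPolynomial (Fin n) K} : f ∈ vanishingIdeal K V ↔ V ⊆ zeroSet f := by
  simp only [mem_vanishingIdeal_iff, Set.subset_def, zeroSet, Set.mem_ofPred_eq, aeval_eq_eval]

theorem zeroSet_mul (f g : MvPolynomial (Fin n) K) :
    zeroSet (f * g) = zeroSet f ∪ zeroSet g := by
  ext x
  simp [zeroSet]

theorem IsVariety.inter_zeroSet {V : Set (Fin n → K)} (hV : IsVariety V)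
    (f : MvPolynomial (Fin n) K) : IsVariety (V ∩ zeroSet f) := by
  classical
  obtain ⟨S, rfl⟩ := hV
  refine ⟨insert f S, ?_⟩
  ext x
  simp [zeroSet, and_comm]

theorem IsVariety.zeroLocus_vanishingIdeal {V : Set (Fin n → K)} (hV : IsVariety V) :
    zeroLocus K (vanishingIdeal K V) = V := by
  obtain ⟨S, rfl⟩ := hV
  refine Set.Subset.antisymm (fun x hx f hf => ?_) (zeroLocus_vanishingIdeal_le _)
  simpa using hx f (mem_vanishingIdeal_iff_subset_zeroSet.mpr fun y hy => hy f hf)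

theorem vanishingIdeal_injOn_isVariety :
    Set.InjOn (vanishingIdeal K) {V : Set (Fin n → K) | IsVariety V} := fun V hV W hW h => by
  rw [← IsVariety.zeroLocus_vanishingIdeal hV, h, IsVariety.zeroLocus_vanishingIdeal hW]

theorem IsIrreducibleVariety.isPrime_vanishingIdeal {V : Set (Fin n → K)}
    (hV : IsIrreducibleVariety V) : (vanishingIdeal K V).IsPrime := by
  obtain ⟨isVariety, ⟨x, hx⟩, irreducible⟩ := hV
  refine ⟨(Ideal.ne_top_iff_one _).mpr fun h => ?_, fun {f g} hfg => ?_⟩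
  · simpa using h x hx
  simp only [mem_vanishingIdeal_iff_subset_zeroSet, zeroSet_mul] at hfg ⊢
  by_contra! ⟨hf, hg⟩
  refine irreducible ⟨V ∩ zeroSet f, V ∩ zeroSet g, isVariety.inter_zeroSet f,
    isVariety.inter_zeroSet g, Set.inter_ssubset_left_iff.mpr hf,
    Set.inter_ssubset_left_iff.mpr hg, ?_⟩
  rw [← Set.inter_union_distrib_left, Set.inter_eq_left.mpr hfg]

theorem IsIrreducibleCurve.irreducibleDim_eq_one {γ : Set (Fin n → K)}
    (h : IsIrreducibleCurve γ) : irreducibleDim γ = 1 := by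
  obtain ⟨⟨-, ⟨W, hWγ, -, hW⟩, dim_le_one⟩, irreducible⟩ := h
  refine (dim_le_one γ subset_rfl irreducible).antisymm (hW.ge.trans ?_)
  have le : vanishingIdeal K γ ≤ vanishingIdeal K W := vanishingIdeal_anti_mono hWγ
  exact trdeg_le_of_surjective (Ideal.Quotient.factorₐ K le) (Ideal.Quotient.factor_surjective le)

theorem encard_irreducibleVariety_le {f g : MvPolynomial (Fin (n + 2)) K} (hfg : IsRelPrime f g) :
    {V : Set (Fin (n + 2) → K) | IsIrreducibleVariety V ∧ irreducibleDim V = n ∧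
        V ⊆ zeroSet f ∧ V ⊆ zeroSet g}.encard ≤ ((f.totalDegree * g.totalDegree : ℕ) : ℕ∞) := by
  by_contra! hlt
  obtain ⟨t, ht, encard_t⟩ := Set.exists_subset_encard_eq (Order.add_one_le_of_lt hlt)
  have := (Set.finite_of_encard_eq_coe (k := f.totalDegree * g.totalDegree + 1)
    (by exact_mod_cast encard_t)).fintype
  have (V : t) := (ht V.2).1.isPrime_vanishingIdeal
  have injective : Function.Injective fun V : t => vanishingIdeal K (V : Set (Fin (n + 2) → K)) :=
    fun V W h => Subtype.ext (vanishingIdeal_injOn_isVariety (ht V.2).1.1 (ht W.2).1.1 h)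
  have card_le := card_le_totalDegree_mul_totalDegree (Fintype.card_fin _) injective
    (fun V => (ht V.2).2.1) hfg
    (fun V => mem_vanishingIdeal_iff_subset_zeroSet.mpr (ht V.2).2.2.1)
    (fun V => mem_vanishingIdeal_iff_subset_zeroSet.mpr (ht V.2).2.2.2)
  have card_eq : Fintype.card t = f.totalDegree * g.totalDegree + 1 := by
    rw [← Set.coe_fintypeCard] at encard_t
    exact_mod_cast encard_t
  lia

end Varieties

section SquarefreePart

variable {K : Type*} [Field K] {n : ℕ}

theorem squarefree_squarefreePart (p : MvPolynomial (Fin n) K) : Squarefree (squarefreePart p) :=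
  letI : StrongNormalizationMonoid (MvPolynomial (Fin n) K) :=
    UniqueFactorizationMonoid.strongNormalizationMonoid
  UniqueFactorizationMonoid.squarefree_radical

theorem squarefreePart_dvd (p : MvPolynomial (Fin n) K) : squarefreePart p ∣ p :=
  letI : StrongNormalizationMonoid (MvPolynomial (Fin n) K) :=
    UniqueFactorizationMonoid.strongNormalizationMonoid
  UniqueFactorizationMonoid.radical_dvd_self

theorem exists_dvd_squarefreePart_pow {p : MvPolynomial (Fin n) K} (hp : p ≠ 0) :
    ∃ k, p ∣ squarefreePart p ^ k :=
  letI : StrongNormalizationMonoid (MvPolynomial (Fin n) K) :=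
    UniqueFactorizationMonoid.strongNormalizationMonoid
  UniqueFactorizationMonoid.exists_dvd_radical_self_pow hp

theorem zeroSet_subset_zeroSet_squarefreePart {p : MvPolynomial (Fin n) K} (hp : p ≠ 0) :
    zeroSet p ⊆ zeroSet (squarefreePart p) := fun x hx => by
  obtain ⟨k, hk⟩ := exists_dvd_squarefreePart_pow hp
  have eval_pow_eq_zero := map_dvd (eval x) hk
  rw [show eval x p = 0 from hx, zero_dvd_iff, map_pow] at eval_pow_eq_zero
  exact eq_zero_of_pow_eq_zero eval_pow_eq_zero

theorem IsCritical.subset_zeroSet_dirDeriv {p : MvPolynomial (Fin n) K} {γ : Set (Fin n → K)}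
    (h : IsCritical p γ) (v : Fin n → K) : γ ⊆ zeroSet (dirDeriv v (squarefreePart p)) :=
  fun x hx => (eval_dirDeriv v x _).trans <|
    Finset.sum_eq_zero fun i _ => by rw [(h x hx).2 i, mul_zero]

end SquarefreePart

end AffineGeometry


open AffineGeometry in
theorem corollary4p1p14_general {K : Type*} [Field K] [CharZero K] {n : ℕ}
    {p : MvPolynomial (Fin (n + 2)) K} (hp : p ≠ 0) :
    {V : Set (Fin (n + 2) → K) | IsIrreducibleVariety V ∧ irreducibleDim V = n ∧
        IsCritical p V}.encard ≤ ((p.totalDegree * (p.totalDegree - 1) : ℕ) : ℕ∞) := by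
  obtain ⟨v, isRelPrime⟩ := exists_isRelPrime_dirDeriv (squarefree_squarefreePart p)
  have degree_le : (squarefreePart p).totalDegree ≤ p.totalDegree :=
    MvPolynomial.totalDegree_le_of_dvd_of_isDomain (squarefreePart_dvd p) hp
  refine (Set.encard_le_encard ?_).trans ((encard_irreducibleVariety_le isRelPrime).trans ?_)
  · rintro V ⟨irreducible, dim, critical⟩
    exact ⟨irreducible, dim,
      fun x hx => zeroSet_subset_zeroSet_squarefreePart hp (critical x hx).1,
      critical.subset_zeroSet_dirDeriv v⟩
  · gcongr
    exact (totalDegree_dirDeriv_le v _).trans (Nat.sub_le_sub_right degree_le 1)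

theorem corollary4p1p14 (p : MvPolynomial (Fin 3) ℝ) (hp : p ≠ 0) :
    {γ : Set (Fin 3 → ℝ) | AffineGeometry.IsIrreducibleCurve γ ∧
        γ ⊆ AffineGeometry.zeroSet p ∧ AffineGeometry.IsCritical p γ}.encard ≤
      ((p.totalDegree ^ 2 : ℕ) : ℕ∞) := by
  refine (Set.encard_le_encard ?_).trans ((corollary4p1p14_general (n := 1) hp).trans ?_)
  · rintro γ ⟨curve, -, critical⟩
    exact ⟨curve.2, by simpa using curve.irreducibleDim_eq_one, critical⟩
  · exact_mod_cast (Nat.mul_le_mul_left _ (Nat.sub_le _ 1)).trans_eq (sq _).symm
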